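/- Let $t$ be an even integer with $t\ge 8$. Then there exists an $(8t,8,\{3,5\},1)$-$2$-perfect difference family, that is, a family $\mathcal F$ of subsets (base blocks) of $\mathbb Z_{8t}$ such that (1) every $B\in\mathcal F$ has $|B|\in\{3,5\}$; (2) the list of all differences $x-y$, where $x,y\in B$, $x\ne y$, $B\in\mathcal F$, contains every element of $\mathbb Z_{8t}\setminus\{0,t,2t,\dots,7t\}$ exactly once and no element of $\{0,t,2t,\dots,7t\}$; (3) every $B\in\mathcal F$ contains $0$, and every nonzero element of $B$ is the residue modulo $8t$ of an integer $a+4bt$ with $0\le a\le 2t$, $a\not\equiv 0\pmod t$ and $b\in\{0,1\}$. -/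

import Mathlib

/-- The list of differences `ΔB = {x - y : x, y ∈ B, x ≠ y}` of a subset `B` of `ZMod n`,
as a multiset (one entry for every ordered pair of distinct elements). -/
def blockDifferences {n : ℕ} (B : Finset (ZMod n)) : Multiset (ZMod n) :=
  B.offDiag.val.map fun p => p.1 - p.2

/-- The list of differences `Δℱ = ⋃ ΔB` (`B ∈ ℱ`) of a family of base blocks, as a multiset. -/
def familyDifferences {n : ℕ} (F : Finset (Finset (ZMod n))) : Multiset (ZMod n) :=
  ∑ B ∈ F, blockDifferences B

/-- The set `{0, t, 2t, …, (g - 1)t}` in `ZMod (g * t)`. -/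
def hole (g t : ℕ) : Set (ZMod (g * t)) :=
  {x | ∃ i : ℕ, i < g ∧ x = ((i * t : ℕ) : ZMod (g * t))}

/-- `F` is a `(gt, g, K, 1)`-cyclic difference family (used for positive `g` and `t`): every
base block has its size in `K`, and the differences cover every element outside
`{0, t, …, (g - 1)t}` exactly once and no element of `{0, t, …, (g - 1)t}`. -/
structure IsCyclicDifferenceFamily (g t : ℕ) (K : Set ℕ)
    (F : Finset (Finset (ZMod (g * t)))) : Prop where
  card_mem : ∀ B ∈ F, B.card ∈ K
  count_eq_one : ∀ d : ZMod (g * t), d ∉ hole g t → (familyDifferences F).count d = 1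
  count_eq_zero : ∀ d : ZMod (g * t), d ∈ hole g t → (familyDifferences F).count d = 0

/-- `F` is an `(hgt, hg, K, 1)`-`h`-perfect difference family (used for positive `h`, `g`, `t`):
an `(hgt, hg, K, 1)`-cyclic difference family all of whose base blocks contain `0` and have
their other elements in
`{a + b g t : 0 ≤ a ≤ ⌊g t / 2⌋, a ≢ 0 (mod t), 0 ≤ b ≤ h - 1}`. -/
structure IsPerfectDifferenceFamily (h g t : ℕ) (K : Set ℕ)
    (F : Finset (Finset (ZMod (h * g * t)))) : Prop where
  isCyclicDifferenceFamily : IsCyclicDifferenceFamily (h * g) t K F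
  zero_mem : ∀ B ∈ F, (0 : ZMod (h * g * t)) ∈ B
  ele_subset : ∀ B ∈ F, ∀ x ∈ B, x ≠ 0 →
    ∃ a b : ℕ, a ≤ g * t / 2 ∧ ¬ t ∣ a ∧ b < h ∧ x = ((a + b * (g * t) : ℕ) : ZMod (h * g * t))

/-! A block whose elements are `p + 4tc`, with `0 ≤ p < 2t` and `c` a bit, is a ruler with
two-coloured marks. Since `8t = 0`, the difference of two marks depends only on their distance and
the sum of their colours. Up to sign, the residues off the hole are the pairs (distance, colour)
with distance in `{1, …, 2t - 1} \ {t}`.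

Counting replaces any check of uniqueness: at least `8t - 8` residues lie off the hole, so a family
with at most `8t - 8` differences that covers them all hits each exactly once and nothing else
(`IsRulerSystem.exists_isPerfectDifferenceFamily`).

The rulers are explicit. For each class of `t` modulo 6 there are four progressions of triples and a
few sporadic rulers that fill the gaps; seven small values of `t` have their own lists. -/

/-! ### Coloured rulers -/

/-- The residue modulo `8 * t` coded by the mark `(p, c)`: the integer `p`, shifted by `4 * t` when
the colour `c` is `true`. -/
def markResidue (t : ℕ) (x : ℕ × Bool) : ZMod (2 * 4 * t) :=
  ((x.1 + x.2.toNat * (4 * t) : ℕ) : ZMod (2 * 4 * t))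

/-- A coloured ruler: three or five marks with increasing positions below `2 * t`, the first one
being `(0, false)` and no other one having a position divisible by `t`. -/
def IsColoredRuler (t : ℕ) (R : List (ℕ × Bool)) : Prop :=
  (R.length = 3 ∨ R.length = 5) ∧ R.Pairwise (fun x y => x.1 < y.1) ∧ (0, false) ∈ R ∧
    ∀ x ∈ R, x ≠ (0, false) → x.1 ≠ 0 ∧ x.1 < 2 * t ∧ x.1 ≠ t

/-- No two marks of the ruler `R` are at distance `a` with colours adding up to `c`. -/
def Avoids (R : List (ℕ × Bool)) (a : ℕ) (c : Bool) : Prop :=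
  R.Pairwise fun x y => y.1 = x.1 + a → (x.2 ^^ y.2) ≠ c

/-- The coloured rulers in `L` measure every distance in `{1, …, 2 * t - 1} \ {t}` with both
colours, and have no room for measuring a distance twice. -/
def IsRulerSystem (t : ℕ) (L : List (List (ℕ × Bool))) : Prop :=
  (∀ R ∈ L, IsColoredRuler t R) ∧
  (L.map fun R => R.length * (R.length - 1)).sum ≤ 8 * t - 8 ∧
  ∀ a < 2 * t, a ≠ 0 → a ≠ t → ∀ c, ∃ R ∈ L, ¬ Avoids R a c

instance (t : ℕ) (R : List (ℕ × Bool)) : Decidable (IsColoredRuler t R) := by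
  unfold IsColoredRuler; infer_instance

instance (R : List (ℕ × Bool)) (a : ℕ) (c : Bool) : Decidable (Avoids R a c) := by
  unfold Avoids; infer_instance

instance (t : ℕ) (L : List (List (ℕ × Bool))) : Decidable (IsRulerSystem t L) := by
  unfold IsRulerSystem; infer_instance

/-! ### From coloured rulers to difference families -/

/-- The base block coded by a coloured ruler. -/
def rulerBlock (t : ℕ) (R : List (ℕ × Bool)) : Finset (ZMod (2 * 4 * t)) :=
  (R.map (markResidue t)).toFinset

theorem mem_rulerBlock {t : ℕ} {R : List (ℕ × Bool)} {x : ℕ × Bool} (hx : x ∈ R) :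
    markResidue t x ∈ rulerBlock t R := by
  simp only [rulerBlock, List.mem_toFinset, List.mem_map]
  exact ⟨x, hx, rfl⟩

/-- The coded integers lie in `[0, 2t)` or `[4t, 6t)`, according to colour, so none wraps around
modulo `8t`. -/
theorem markResidue_injective {t : ℕ} {x y : ℕ × Bool} (hx : x.1 < 2 * t) (hy : y.1 < 2 * t)
    (h : markResidue t x = markResidue t y) : x = y := by
  obtain ⟨p, c⟩ := x
  obtain ⟨r, d⟩ := y
  simp only [markResidue, ZMod.natCast_eq_natCast_iff'] at h hx hy
  cases c <;> cases d <;>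
    simp only [Bool.toNat_true, Bool.toNat_false] at h <;>
    rw [Nat.mod_eq_of_lt (by omega), Nat.mod_eq_of_lt (by omega)] at h <;>
    simp only [Prod.mk.injEq] <;> simp <;> omega

theorem IsColoredRuler.lt {t : ℕ} (ht : 0 < t) {R : List (ℕ × Bool)} (hR : IsColoredRuler t R)
    {x : ℕ × Bool} (hx : x ∈ R) : x.1 < 2 * t := by
  by_cases h : x = (0, false)
  · subst h; simpa using ht
  · exact (hR.2.2.2 x hx h).2.1

theorem IsColoredRuler.card_rulerBlock {t : ℕ} (ht : 0 < t) {R : List (ℕ × Bool)}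
    (hR : IsColoredRuler t R) : (rulerBlock t R).card = R.length := by
  have hnd : R.Nodup := hR.2.1.imp fun {x y} h e => by subst e; exact lt_irrefl _ h
  rw [rulerBlock, List.toFinset_card_of_nodup, List.length_map]
  exact hnd.map_on fun x hx y hy h => markResidue_injective (hR.lt ht hx) (hR.lt ht hy) h

/-- Colours add modulo 2 because two shifts by `4t` cancel in `ZMod (2 * 4 * t)`. -/
theorem markResidue_add {t a : ℕ} {c : Bool} {x y : ℕ × Bool} (h : y.1 = x.1 + a)
    (hc : (x.2 ^^ y.2) = c) : markResidue t y = markResidue t x + markResidue t (a, c) := by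
  obtain ⟨p, d⟩ := x
  obtain ⟨r, e⟩ := y
  simp only at h hc
  subst h hc
  have h8 : ((2 * 4 * t : ℕ) : ZMod (2 * 4 * t)) = 0 := ZMod.natCast_self _
  push_cast at h8
  cases d <;> cases e <;> simp [markResidue]
  · ring
  · linear_combination -h8
  · ring

/-- An upper bound suffices for the count, so the coded blocks need not be shown distinct. -/
theorem sum_toFinset_le_sum_map {α : Type*} [DecidableEq α] (f : α → ℕ) (l : List α) :
    ∑ x ∈ l.toFinset, f x ≤ (l.map f).sum := by
  induction l with
  | nil => simp
  | cons a l ih =>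
    rw [List.toFinset_cons, List.map_cons, List.sum_cons]
    by_cases h : a ∈ l.toFinset
    · rw [Finset.insert_eq_of_mem h]; omega
    · rw [Finset.sum_insert h]; omega

theorem card_blockDifferences {n : ℕ} (B : Finset (ZMod n)) :
    (blockDifferences B).card = B.card * (B.card - 1) := by
  rw [blockDifferences, Multiset.card_map, Finset.card_val, Finset.offDiag_card, Nat.mul_sub,
    mul_one]

/-- Up to sign, every residue off the hole is coded by a mark with a position in
`{1, …, 2 * t - 1} \ {t}`. -/
theorem exists_markResidue_of_notMem_hole {t : ℕ} (ht : 0 < t) {d : ZMod (2 * 4 * t)}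
    (hd : d ∉ hole (2 * 4) t) :
    ∃ a c, a < 2 * t ∧ a ≠ 0 ∧ a ≠ t ∧
      (d = markResidue t (a, c) ∨ -d = markResidue t (a, c)) := by
  have : NeZero (2 * 4 * t) := ⟨by omega⟩
  have hlt : d.val < 2 * 4 * t := ZMod.val_lt d
  have hval : ((d.val : ℕ) : ZMod (2 * 4 * t)) = d := ZMod.natCast_zmod_val d
  have hne : ∀ i < 8, d.val ≠ i * t := fun i hi h => hd ⟨i, hi, by rw [← h, hval]⟩
  have h0 := hne 0 (by norm_num)
  have h1 := hne 1 (by norm_num)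
  have h2 := hne 2 (by norm_num)
  have h3 := hne 3 (by norm_num)
  have h4 := hne 4 (by norm_num)
  have h5 := hne 5 (by norm_num)
  have h6 := hne 6 (by norm_num)
  have h7 := hne 7 (by norm_num)
  have neg : ∀ m : ℕ, d.val + m = 2 * 4 * t → -d = (m : ZMod (2 * 4 * t)) := fun m hm => by
    rw [neg_eq_iff_add_eq_zero, ← hval, ← Nat.cast_add, hm, ZMod.natCast_self]
  rcases lt_or_ge d.val (2 * t) with h | h
  -- The four quarters of `[0, 8t)`: the second and fourth are negated, landing in `[4t, 6t]`
  -- (colour `true`) and `[0, 2t]` (colour `false`). The endpoints belong to the hole.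
  · exact ⟨d.val, false, h, by omega, by omega, Or.inl (by simp [markResidue, hval])⟩
  rcases lt_or_ge d.val (4 * t) with h' | h'
  · refine ⟨4 * t - d.val, true, by omega, by omega, by omega, Or.inr (neg _ ?_)⟩
    simp only [Bool.toNat_true]; omega
  rcases lt_or_ge d.val (6 * t) with h'' | h''
  · refine ⟨d.val - 4 * t, true, by omega, by omega, by omega, Or.inl ?_⟩
    rw [markResidue, ← hval]
    congr 1
    simp only [Bool.toNat_true, hval]; omega
  · refine ⟨8 * t - d.val, false, by omega, by omega, by omega, Or.inr (neg _ ?_)⟩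
    simp only [Bool.toNat_false]; omega

theorem mem_blockDifferences_of_not_avoids {t a : ℕ} {c : Bool} {R : List (ℕ × Bool)}
    {d : ZMod (2 * 4 * t)} (h : ¬ Avoids R a c) (hd0 : d ≠ 0)
    (hd : d = markResidue t (a, c) ∨ -d = markResidue t (a, c)) :
    d ∈ blockDifferences (rulerBlock t R) := by
  obtain ⟨x, hx, y, hy, hxy, hc⟩ : ∃ x ∈ R, ∃ y ∈ R, y.1 = x.1 + a ∧ (x.2 ^^ y.2) = c := by
    by_contra! h'
    exact h (List.pairwise_of_forall_mem_list h')
  have hadd := markResidue_add (t := t) hxy hc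
  have key : d = markResidue t y - markResidue t x ∨ d = markResidue t x - markResidue t y :=
    hd.imp (fun h => by rw [h, hadd]; ring) fun h => by rw [hadd, ← h]; ring
  rw [blockDifferences, Multiset.mem_map]
  rcases key with h | h
  · refine ⟨(markResidue t y, markResidue t x), ?_, h.symm⟩
    rw [Finset.mem_val, Finset.mem_offDiag]
    exact ⟨mem_rulerBlock hy, mem_rulerBlock hx, fun e => hd0 (h.trans (sub_eq_zero.2 e))⟩
  · refine ⟨(markResidue t x, markResidue t y), ?_, h.symm⟩
    rw [Finset.mem_val, Finset.mem_offDiag]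
    exact ⟨mem_rulerBlock hx, mem_rulerBlock hy, fun e => hd0 (h.trans (sub_eq_zero.2 e))⟩

theorem le_card_compl_hole {g t : ℕ} [NeZero (g * t)] [DecidablePred (· ∉ hole g t)] :
    g * t - g ≤ (Finset.univ.filter (· ∉ hole g t)).card := by
  classical
  have h1 : (Finset.univ.filter (· ∈ hole g t)).card ≤ g := by
    calc _ ≤ ((Finset.range g).image fun i => ((i * t : ℕ) : ZMod (g * t))).card := by
          refine Finset.card_le_card fun x hx => ?_
          obtain ⟨i, hi, rfl⟩ := (Finset.mem_filter.1 hx).2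
          exact Finset.mem_image.2 ⟨i, Finset.mem_range.2 hi, rfl⟩
      _ ≤ g := Finset.card_image_le.trans (Finset.card_range g).le
  have h2 := Finset.card_filter_add_card_filter_not
    (s := (Finset.univ : Finset (ZMod (g * t)))) (· ∈ hole g t)
  rw [Finset.card_univ, ZMod.card] at h2
  have h3 : (Finset.univ.filter (· ∉ hole g t)).card
      = (Finset.univ.filter fun a => ¬ a ∈ hole g t).card := by congr
  omega

theorem IsRulerSystem.exists_isPerfectDifferenceFamily {t : ℕ} (ht : 0 < t)
    {L : List (List (ℕ × Bool))} (hL : IsRulerSystem t L) :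
    ∃ F : Finset (Finset (ZMod (2 * 4 * t))), IsPerfectDifferenceFamily 2 4 t {3, 5} F := by
  classical
  have : NeZero (2 * 4 * t) := ⟨by omega⟩
  obtain ⟨hR, hsum, hcov⟩ := hL
  set F := (L.map (rulerBlock t)).toFinset with hF
  have hmem : ∀ B ∈ F, ∃ R ∈ L, rulerBlock t R = B := fun B hB => by
    simpa [hF] using hB
  have hcard : (familyDifferences F).card ≤ 2 * 4 * t - 2 * 4 := by
    rw [familyDifferences, Multiset.card_sum]
    calc ∑ B ∈ F, (blockDifferences B).card
        ≤ ((L.map (rulerBlock t)).map fun B => (blockDifferences B).card).sum :=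
          sum_toFinset_le_sum_map _ _
      _ = (L.map fun R => R.length * (R.length - 1)).sum := by
          rw [List.map_map]
          refine congrArg List.sum (List.map_congr_left fun R h => ?_)
          rw [Function.comp_apply, card_blockDifferences, (hR R h).card_rulerBlock ht]
      _ ≤ _ := by omega
  have hsub : (Finset.univ.filter (· ∉ hole (2 * 4) t)).val ≤ familyDifferences F := by
    -- The left side has no repetitions, so covering each residue once is enough.
    rw [Finset.val_le_iff_val_subset]
    intro d hd
    have hd' : d ∉ hole (2 * 4) t := by simpa using hd
    obtain ⟨a, c, ha, ha0, hat, hac⟩ := exists_markResidue_of_notMem_hole ht hd'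
    obtain ⟨R, hRL, hm⟩ := hcov a ha ha0 hat c
    have hd0 : d ≠ 0 := fun h => hd' ⟨0, by norm_num, by simp [h]⟩
    rw [familyDifferences, Multiset.mem_sum]
    exact ⟨rulerBlock t R, by simpa [hF] using ⟨R, hRL, rfl⟩,
      mem_blockDifferences_of_not_avoids hm hd0 hac⟩
  -- The cardinality bound turns covering into equality of multisets.
  have heq := Multiset.eq_of_le_of_card_le hsub (hcard.trans le_card_compl_hole)
  refine ⟨F, ⟨fun B hB => ?_, fun d hd => ?_, fun d hd => ?_⟩, fun B hB => ?_,
    fun B hB x hx hx0 => ?_⟩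
  · obtain ⟨R, hRL, rfl⟩ := hmem B hB
    rw [(hR R hRL).card_rulerBlock ht]
    exact (hR R hRL).1
  · rw [← heq]
    exact Multiset.count_eq_one_of_mem (Finset.nodup _) (by simpa using hd)
  · rw [← heq, Multiset.count_eq_zero]
    simpa using hd
  · obtain ⟨R, hRL, rfl⟩ := hmem B hB
    simpa [markResidue] using mem_rulerBlock (t := t) (hR R hRL).2.2.1
  · obtain ⟨R, hRL, rfl⟩ := hmem B hB
    simp only [rulerBlock, List.mem_toFinset, List.mem_map] at hx
    obtain ⟨m, hm, rfl⟩ := hx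
    have hm0 : m ≠ (0, false) := fun h => hx0 (by simp [h, markResidue])
    obtain ⟨h0, h2, h1⟩ := (hR R hRL).2.2.2 m hm hm0
    refine ⟨m.1, m.2.toNat, by omega, ?_, by cases m.2 <;> simp, rfl⟩
    rintro ⟨k, hk⟩
    have : k < 2 := by
      by_contra! h
      have := Nat.mul_le_mul_left t h
      omega
    interval_cases k <;> omega

theorem isColoredRuler_three {t p r : ℕ} {c d : Bool} (hp : p ≠ 0 ∧ p ≠ t) (hr : r ≠ t ∧ r < 2 * t)
    (hpr : p < r) : IsColoredRuler t [(0, false), (p, c), (r, d)] := by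
  simp [IsColoredRuler]
  omega

theorem isColoredRuler_five {t p₁ p₂ p₃ p₄ : ℕ} {c₁ c₂ c₃ c₄ : Bool}
    (h₁ : p₁ ≠ 0 ∧ p₁ ≠ t) (h₂ : p₁ < p₂ ∧ p₂ ≠ t) (h₃ : p₂ < p₃ ∧ p₃ ≠ t)
    (h₄ : p₃ < p₄ ∧ p₄ ≠ t ∧ p₄ < 2 * t) :
    IsColoredRuler t [(0, false), (p₁, c₁), (p₂, c₂), (p₃, c₃), (p₄, c₄)] := by
  simp [IsColoredRuler]
  omega

/-! ### Three infinite families of ruler systems -/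

/-- A system of coloured rulers for `t = 6 * k + 36`. -/
def rulersModZero (k : ℕ) : List (List (ℕ × Bool)) :=
  [[(0, false), (1, false), (12 * k + 71, true)],
   [(0, false), (2, false), (8 * k + 46, false)],
   [(0, false), (3 * k + 18, true), (12 * k + 71, false)],
   [(0, false), (4 * k + 18, false), (12 * k + 68, false)],
   [(0, false), (4 * k + 20, false), (10 * k + 60, false)],
   [(0, false), (4 * k + 22, false), (8 * k + 48, false)],
   [(0, false), (6 * k + 34, true), (12 * k + 69, false)],
   [(0, false), (4 * k + 16, false), (4 * k + 24, false), (4 * k + 28, false),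
    (10 * k + 58, false)],
   [(0, false), (6 * k + 32, false), (12 * k + 67, false), (12 * k + 69, true),
    (12 * k + 70, false)]] ++
  (List.range k).map (fun i =>
    [(0, false), (4 * i + 16, false), (6 * k + 2 * i + 44, false)]) ++
  (List.range (k + 3)).map (fun i =>
    [(0, false), (4 * i + 6, false), (10 * k + 2 * i + 62, false)]) ++
  (List.range (3 * k + 15)).map (fun i =>
    [(0, false), (i + 3, true), (12 * k + 68 - i, true)]) ++
  (List.range (3 * k + 15)).map (fun i =>
    [(0, false), (3 * k + i + 19, true), (9 * k + 52 - i, true)])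

-- A triple gives 6 differences and a five-mark ruler 20. Here `8t - 8 ≡ 4` modulo 6, which two
-- five-mark rulers account for.
set_option maxHeartbeats 400000 in
theorem isRulerSystem_rulersModZero (k : ℕ) : IsRulerSystem (6 * k + 36) (rulersModZero k) := by
  refine ⟨fun R hR => ?_, ?_, fun a ha ha0 hat c => ?_⟩
  · simp only [rulersModZero, List.mem_append, List.mem_cons, List.not_mem_nil, or_false,
      List.mem_map, List.mem_range] at hR
    rcases hR with ((((rfl | rfl | rfl | rfl | rfl | rfl | rfl | rfl | rfl) |
      ⟨i, hi, rfl⟩) | ⟨i, hi, rfl⟩) | ⟨i, hi, rfl⟩) | ⟨i, hi, rfl⟩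
    all_goals first
      | exact isColoredRuler_three (by omega) (by omega) (by omega)
      | exact isColoredRuler_five (by omega) (by omega) (by omega) (by omega)
  · simp [rulersModZero, Function.comp_def]
    omega
  by_contra! h
  simp only [rulersModZero, List.forall_mem_append, List.forall_mem_cons, List.forall_mem_map,
    List.mem_range, Avoids, List.pairwise_cons, zero_add] at h
  -- `h₀` holds the sporadic rulers. The triples in `h₁`, `h₂` measure even distances of colour
  -- `false`; those in `h₃`, `h₄` measure two distances of colour `true` and an odd one of colour
  -- `false`.
  obtain ⟨⟨⟨⟨h₀, h₁⟩, h₂⟩, h₃⟩, h₄⟩ := h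
  cases c <;> simp [-not_and] at h₀ h₁ h₂ h₃ h₄
  · rcases Nat.mod_two_eq_zero_or_one a with h | h
    · rcases lt_or_ge a (6 * k + 36) with h' | h'
      · rcases lt_or_ge a (4 * k + 29) with h'' | h''
        -- Each exclusion solves one distance of a progression for its index; `h₀` covers what is
        -- left.
        · have e₁ : ¬(a % 4 = 0 ∧ 16 ≤ a ∧ a < 4 * k + 16) := fun _ =>
            (h₁ (a / 4 - 4) (by omega)).1.1 (by omega)
          have e₂ : ¬(a % 4 = 2 ∧ 6 ≤ a ∧ a < 4 * k + 18) := fun _ =>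
            (h₂ (a / 4 - 1) (by omega)).1.1 (by omega)
          clear h₁ h₂ h₃ h₄
          omega
        · have e₁ : ¬(4 * k + 28 < a ∧ a ≤ 6 * k + 28) := fun _ =>
            (h₁ ((6 * k + 28 - a) / 2) (by omega)).2 (by omega)
          clear h₁ h₂ h₃ h₄
          omega
      · rcases lt_or_ge a (8 * k + 51) with h'' | h''
        · have e₁ : ¬(6 * k + 44 ≤ a ∧ a < 8 * k + 44) := fun _ =>
            (h₁ ((a - (6 * k + 44)) / 2) (by omega)).1.2 (by omega)
          clear h₁ h₂ h₃ h₄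
          omega
        · have e₁ : ¬(8 * k + 50 < a ∧ a ≤ 10 * k + 56) := fun _ =>
            (h₂ ((10 * k + 56 - a) / 2) (by omega)).2 (by omega)
          have e₂ : ¬(10 * k + 62 ≤ a ∧ a < 12 * k + 68) := fun _ =>
            (h₂ ((a - (10 * k + 62)) / 2) (by omega)).1.2 (by omega)
          clear h₁ h₂ h₃ h₄
          omega
    · have e₁ : ¬(6 * k + 35 < a ∧ a ≤ 12 * k + 65) := fun _ =>
        h₃ ((12 * k + 65 - a) / 2) (by omega) (by omega)
      have e₂ : ¬(3 < a ∧ a ≤ 6 * k + 33) := fun _ =>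
        h₄ ((6 * k + 33 - a) / 2) (by omega) (by omega)
      clear h₁ h₂ h₃ h₄
      omega
  -- The progressions skip `3k + 18` and `9k + 53`; the sporadic ruler with marks at `0`, `3k + 18`,
  -- `12k + 71` measures both.
  · have e₁ : ¬(3 ≤ a ∧ a < 3 * k + 18) := fun _ =>
      (h₃ (a - 3) (by omega)).1 (by omega)
    have e₂ : ¬(9 * k + 53 < a ∧ a ≤ 12 * k + 68) := fun _ =>
      (h₃ (12 * k + 68 - a) (by omega)).2 (by omega)
    have e₃ : ¬(3 * k + 19 ≤ a ∧ a < 6 * k + 34) := fun _ =>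
      (h₄ (a - (3 * k + 19)) (by omega)).1 (by omega)
    have e₄ : ¬(6 * k + 37 < a ∧ a ≤ 9 * k + 52) := fun _ =>
      (h₄ (9 * k + 52 - a) (by omega)).2 (by omega)
    clear h₁ h₂ h₃ h₄
    omega

/-- A system of coloured rulers for `t = 6 * k + 20`. -/
def rulersModOne (k : ℕ) : List (List (ℕ × Bool)) :=
  [[(0, false), (1, true), (6 * k + 19, true)],
   [(0, false), (3, false), (6 * k + 21, true)],
   [(0, false), (4, false), (9, false)],
   [(0, false), (3 * k + 12, true), (12 * k + 39, false)],
   [(0, false), (6 * k + 15, true), (12 * k + 37, false)],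
   [(0, false), (1, false), (6 * k + 17, true), (6 * k + 24, true), (12 * k + 39, true)]] ++
  (List.range (k + 2)).map (fun i =>
    [(0, false), (4 * i + 8, false), (6 * k + 2 * i + 24, false)]) ++
  (List.range (k + 3)).map (fun i =>
    [(0, false), (4 * i + 2, false), (10 * k + 2 * i + 34, false)]) ++
  (List.range (3 * k + 10)).map (fun i =>
    [(0, false), (i + 2, true), (12 * k + 37 - i, true)]) ++
  (List.range (3 * k + 2)).map (fun i =>
    [(0, false), (3 * k + i + 13, true), (9 * k + 26 - i, true)])

-- Here `8t - 8 ≡ 2` modulo 6, so a single five-mark ruler is used; the parity pattern is that of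
-- the previous family.
set_option maxHeartbeats 400000 in
theorem isRulerSystem_rulersModOne (k : ℕ) : IsRulerSystem (6 * k + 20) (rulersModOne k) := by
  refine ⟨fun R hR => ?_, ?_, fun a ha ha0 hat c => ?_⟩
  · simp only [rulersModOne, List.mem_append, List.mem_cons, List.not_mem_nil, or_false,
      List.mem_map, List.mem_range] at hR
    rcases hR with ((((rfl | rfl | rfl | rfl | rfl | rfl) |
      ⟨i, hi, rfl⟩) | ⟨i, hi, rfl⟩) | ⟨i, hi, rfl⟩) | ⟨i, hi, rfl⟩
    all_goals first
      | exact isColoredRuler_three (by omega) (by omega) (by omega)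
      | exact isColoredRuler_five (by omega) (by omega) (by omega) (by omega)
  · simp [rulersModOne, Function.comp_def]
    omega
  by_contra! h
  simp only [rulersModOne, List.forall_mem_append, List.forall_mem_cons, List.forall_mem_map,
    List.mem_range, Avoids, List.pairwise_cons, zero_add] at h
  obtain ⟨⟨⟨⟨h₀, h₁⟩, h₂⟩, h₃⟩, h₄⟩ := h
  cases c <;> simp [-not_and] at h₀ h₁ h₂ h₃ h₄
  · rcases Nat.mod_two_eq_zero_or_one a with h | h
    · rcases lt_or_ge a (6 * k + 20) with h' | h'
      · rcases lt_or_ge a (4 * k + 13) with h'' | h''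
        · have e₁ : ¬(a % 4 = 0 ∧ 8 ≤ a ∧ a < 4 * k + 16) := fun _ =>
            (h₁ (a / 4 - 2) (by omega)).1.1 (by omega)
          have e₂ : ¬(a % 4 = 2 ∧ 2 ≤ a ∧ a < 4 * k + 14) := fun _ =>
            (h₂ (a / 4) (by omega)).1.1 (by omega)
          clear h₁ h₂ h₃ h₄
          omega
        · have e₁ : ¬(4 * k + 12 < a ∧ a ≤ 6 * k + 16) := fun _ =>
            (h₁ ((6 * k + 16 - a) / 2) (by omega)).2 (by omega)
          clear h₁ h₂ h₃ h₄
          omega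
      · rcases lt_or_ge a (8 * k + 27) with h'' | h''
        · have e₁ : ¬(6 * k + 24 ≤ a ∧ a < 8 * k + 28) := fun _ =>
            (h₁ ((a - (6 * k + 24)) / 2) (by omega)).1.2 (by omega)
          clear h₁ h₂ h₃ h₄
          omega
        · have e₁ : ¬(8 * k + 26 < a ∧ a ≤ 10 * k + 32) := fun _ =>
            (h₂ ((10 * k + 32 - a) / 2) (by omega)).2 (by omega)
          have e₂ : ¬(10 * k + 34 ≤ a ∧ a < 12 * k + 40) := fun _ =>
            (h₂ ((a - (10 * k + 34)) / 2) (by omega)).1.2 (by omega)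
          clear h₁ h₂ h₃ h₄
          omega
    · have e₁ : ¬(6 * k + 15 < a ∧ a ≤ 12 * k + 35) := fun _ =>
        h₃ ((12 * k + 35 - a) / 2) (by omega) (by omega)
      have e₂ : ¬(9 < a ∧ a ≤ 6 * k + 13) := fun _ =>
        h₄ ((6 * k + 13 - a) / 2) (by omega) (by omega)
      clear h₁ h₂ h₃ h₄
      omega
  · have e₁ : ¬(2 ≤ a ∧ a < 3 * k + 12) := fun _ =>
      (h₃ (a - 2) (by omega)).1 (by omega)
    have e₂ : ¬(9 * k + 27 < a ∧ a ≤ 12 * k + 37) := fun _ =>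
      (h₃ (12 * k + 37 - a) (by omega)).2 (by omega)
    have e₃ : ¬(3 * k + 13 ≤ a ∧ a < 6 * k + 15) := fun _ =>
      (h₄ (a - (3 * k + 13)) (by omega)).1 (by omega)
    have e₄ : ¬(6 * k + 24 < a ∧ a ≤ 9 * k + 26) := fun _ =>
      (h₄ (9 * k + 26 - a) (by omega)).2 (by omega)
    clear h₁ h₂ h₃ h₄
    omega

/-- A system of coloured rulers for `t = 6 * k + 16`. -/
def rulersModTwo (k : ℕ) : List (List (ℕ × Bool)) :=
  [[(0, false), (1, false), (12 * k + 31, true)],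
   [(0, false), (1, true), (6 * k + 15, true)],
   [(0, false), (2, false), (10 * k + 26, false)],
   [(0, false), (4, false), (4 * k + 12, false)],
   [(0, false), (3 * k + 10, true), (12 * k + 31, false)],
   [(0, false), (4 * k + 6, false), (12 * k + 28, false)],
   [(0, false), (4 * k + 10, false), (12 * k + 30, false)],
   [(0, false), (6 * k + 11, false), (12 * k + 29, false)]] ++
  (List.range k).map (fun i =>
    [(0, false), (4 * i + 8, false), (6 * k + 2 * i + 20, false)]) ++
  (List.range k).map (fun i =>
    [(0, false), (4 * i + 6, false), (10 * k + 2 * i + 28, false)]) ++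
  (List.range (3 * k + 8)).map (fun i =>
    [(0, false), (i + 2, true), (12 * k + 29 - i, true)]) ++
  (List.range (3 * k + 4)).map (fun i =>
    [(0, false), (3 * k + i + 11, true), (9 * k + 20 - i, true)])

-- Here 6 divides `8t - 8`, and triples alone suffice.
set_option maxHeartbeats 400000 in
theorem isRulerSystem_rulersModTwo (k : ℕ) : IsRulerSystem (6 * k + 16) (rulersModTwo k) := by
  refine ⟨fun R hR => ?_, ?_, fun a ha ha0 hat c => ?_⟩
  · simp only [rulersModTwo, List.mem_append, List.mem_cons, List.not_mem_nil, or_false,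
      List.mem_map, List.mem_range] at hR
    rcases hR with ((((rfl | rfl | rfl | rfl | rfl | rfl | rfl | rfl) |
      ⟨i, hi, rfl⟩) | ⟨i, hi, rfl⟩) | ⟨i, hi, rfl⟩) | ⟨i, hi, rfl⟩
    all_goals first
      | exact isColoredRuler_three (by omega) (by omega) (by omega)
  · simp [rulersModTwo, Function.comp_def]
    omega
  by_contra! h
  simp only [rulersModTwo, List.forall_mem_append, List.forall_mem_cons, List.forall_mem_map,
    List.mem_range, Avoids, List.pairwise_cons, zero_add] at h
  obtain ⟨⟨⟨⟨h₀, h₁⟩, h₂⟩, h₃⟩, h₄⟩ := h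
  cases c <;> simp [-not_and] at h₀ h₁ h₂ h₃ h₄
  · rcases Nat.mod_two_eq_zero_or_one a with h | h
    · rcases lt_or_ge a (6 * k + 16) with h' | h'
      · rcases lt_or_ge a (4 * k + 13) with h'' | h''
        · have e₁ : ¬(a % 4 = 0 ∧ 8 ≤ a ∧ a < 4 * k + 8) := fun _ =>
            (h₁ (a / 4 - 2) (by omega)).1.1 (by omega)
          have e₂ : ¬(a % 4 = 2 ∧ 6 ≤ a ∧ a < 4 * k + 6) := fun _ =>
            (h₂ (a / 4 - 1) (by omega)).1.1 (by omega)
          clear h₁ h₂ h₃ h₄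
          omega
        · have e₁ : ¬(4 * k + 12 < a ∧ a ≤ 6 * k + 12) := fun _ =>
            (h₁ ((6 * k + 12 - a) / 2) (by omega)).2 (by omega)
          clear h₁ h₂ h₃ h₄
          omega
      · rcases lt_or_ge a (8 * k + 23) with h'' | h''
        · have e₁ : ¬(6 * k + 20 ≤ a ∧ a < 8 * k + 20) := fun _ =>
            (h₁ ((a - (6 * k + 20)) / 2) (by omega)).1.2 (by omega)
          clear h₁ h₂ h₃ h₄
          omega
        · have e₁ : ¬(8 * k + 22 < a ∧ a ≤ 10 * k + 22) := fun _ =>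
            (h₂ ((10 * k + 22 - a) / 2) (by omega)).2 (by omega)
          have e₂ : ¬(10 * k + 28 ≤ a ∧ a < 12 * k + 28) := fun _ =>
            (h₂ ((a - (10 * k + 28)) / 2) (by omega)).1.2 (by omega)
          clear h₁ h₂ h₃ h₄
          omega
    · have e₁ : ¬(6 * k + 11 < a ∧ a ≤ 12 * k + 27) := fun _ =>
        h₃ ((12 * k + 27 - a) / 2) (by omega) (by omega)
      have e₂ : ¬(1 < a ∧ a ≤ 6 * k + 9) := fun _ =>
        h₄ ((6 * k + 9 - a) / 2) (by omega) (by omega)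
      clear h₁ h₂ h₃ h₄
      omega
  · have e₁ : ¬(2 ≤ a ∧ a < 3 * k + 10) := fun _ =>
      (h₃ (a - 2) (by omega)).1 (by omega)
    have e₂ : ¬(9 * k + 21 < a ∧ a ≤ 12 * k + 29) := fun _ =>
      (h₃ (12 * k + 29 - a) (by omega)).2 (by omega)
    have e₃ : ¬(3 * k + 11 ≤ a ∧ a < 6 * k + 15) := fun _ =>
      (h₄ (a - (3 * k + 11)) (by omega)).1 (by omega)
    have e₄ : ¬(6 * k + 16 < a ∧ a ≤ 9 * k + 20) := fun _ =>
      (h₄ (9 * k + 20 - a) (by omega)).2 (by omega)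
    clear h₁ h₂ h₃ h₄
    omega

/-! ### Small values of `t` -/

theorem exists_isRulerSystem_8 : ∃ L, IsRulerSystem 8 L :=
  ⟨[[(0, false), (1, false), (6, false)], [(0, false), (2, false), (12, false)],
     [(0, false), (3, true), (15, false)], [(0, false), (4, true), (15, true)],
     [(0, false), (5, true), (14, false)], [(0, false), (6, true), (13, true)],
     [(0, false), (4, false), (11, true), (13, false), (14, true)]],
    by decide +kernel⟩

theorem exists_isRulerSystem_10 : ∃ L, IsRulerSystem 10 L :=
  ⟨[[(0, false), (1, false), (6, false)], [(0, false), (1, true), (15, false)],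
     [(0, false), (2, false), (13, false)], [(0, false), (2, true), (19, true)],
     [(0, false), (3, false), (8, true)], [(0, false), (3, true), (15, true)],
     [(0, false), (4, false), (18, false)], [(0, false), (4, true), (16, false)],
     [(0, false), (6, true), (19, false)], [(0, false), (7, false), (18, true)],
     [(0, false), (7, true), (16, true)], [(0, false), (8, false), (17, true)]],
    by decide +kernel⟩

theorem exists_isRulerSystem_12 : ∃ L, IsRulerSystem 12 L :=
  ⟨[[(0, false), (1, true), (6, false), (17, false), (21, true)],
     [(0, false), (3, false), (8, false), (21, false), (22, false)],
     [(0, false), (2, false), (22, true)], [(0, false), (2, true), (15, false)],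
     [(0, false), (3, true), (10, false)], [(0, false), (4, false), (23, true)],
     [(0, false), (6, true), (16, false)], [(0, false), (7, false), (18, true)],
     [(0, false), (8, true), (17, true)], [(0, false), (9, true), (23, false)]],
    by decide +kernel⟩

theorem exists_isRulerSystem_14 : ∃ L, IsRulerSystem 14 L :=
  ⟨[[(0, false), (2, true), (25, true)], [(0, false), (1, true), (17, true)],
     [(0, false), (2, false), (21, false)], [(0, false), (3, false), (25, false)],
     [(0, false), (3, true), (20, true)], [(0, false), (4, false), (11, true)],
     [(0, false), (5, false), (26, true)], [(0, false), (6, false), (26, false)],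
     [(0, false), (7, false), (23, true)], [(0, false), (8, false), (18, true)],
     [(0, false), (8, true), (27, false)], [(0, false), (9, true), (24, true)],
     [(0, false), (11, false), (24, false)], [(0, false), (12, false), (27, true)],
     [(0, false), (12, true), (13, true), (18, false), (22, true)]],
    by decide +kernel⟩

theorem exists_isRulerSystem_18 : ∃ L, IsRulerSystem 18 L :=
  ⟨[[(0, false), (10, true), (20, true), (21, false), (32, false)],
     [(0, false), (4, true), (7, false), (16, true), (21, true)],
     [(0, false), (1, false), (33, true)], [(0, false), (2, false), (29, false)],
     [(0, false), (2, true), (26, true)], [(0, false), (3, false), (31, true)],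
     [(0, false), (4, false), (26, false)], [(0, false), (5, true), (24, true)],
     [(0, false), (6, false), (34, false)], [(0, false), (6, true), (35, false)],
     [(0, false), (7, true), (30, false)], [(0, false), (8, false), (31, false)],
     [(0, false), (8, true), (33, false)], [(0, false), (9, false), (25, false)],
     [(0, false), (13, false), (30, true)], [(0, false), (13, true), (27, true)],
     [(0, false), (15, false), (34, true)], [(0, false), (15, true), (35, true)]],
    by decide +kernel⟩

theorem exists_isRulerSystem_24 : ∃ L, IsRulerSystem 24 L :=
  ⟨[[(0, false), (1, false), (8, false), (11, false), (15, true)],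
     [(0, false), (2, false), (25, true), (28, false), (39, true)],
     [(0, false), (1, true), (46, true)], [(0, false), (2, true), (45, true)],
     [(0, false), (5, true), (42, true)], [(0, false), (6, true), (41, true)],
     [(0, false), (12, true), (35, true)], [(0, false), (13, true), (34, true)],
     [(0, false), (16, true), (31, true)], [(0, false), (4, false), (32, true)],
     [(0, false), (5, false), (36, false)], [(0, false), (6, false), (33, false)],
     [(0, false), (8, true), (40, true)], [(0, false), (9, false), (38, true)],
     [(0, false), (9, true), (42, false)], [(0, false), (10, true), (40, false)],
     [(0, false), (12, false), (41, false)], [(0, false), (13, false), (47, false)],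
     [(0, false), (16, false), (46, false)], [(0, false), (17, false), (43, true)],
     [(0, false), (17, true), (38, false)], [(0, false), (18, false), (36, true)],
     [(0, false), (19, false), (44, false)], [(0, false), (19, true), (39, false)],
     [(0, false), (20, false), (47, true)], [(0, false), (22, false), (44, true)]],
    by decide +kernel⟩

theorem exists_isRulerSystem_30 : ∃ L, IsRulerSystem 30 L :=
  ⟨[[(0, false), (3, true), (36, false), (38, true), (55, true)],
     [(0, false), (11, false), (18, true), (32, true), (51, true)],
     [(0, false), (4, true), (57, true)], [(0, false), (5, true), (56, true)],
     [(0, false), (9, true), (52, true)], [(0, false), (12, true), (49, true)],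
     [(0, false), (15, true), (46, true)], [(0, false), (16, true), (45, true)],
     [(0, false), (17, true), (44, true)], [(0, false), (20, true), (41, true)],
     [(0, false), (24, true), (37, true)], [(0, false), (27, true), (34, true)],
     [(0, false), (1, false), (6, false)], [(0, false), (1, true), (58, true)],
     [(0, false), (2, false), (50, true)], [(0, false), (3, false), (42, false)],
     [(0, false), (4, false), (59, false)], [(0, false), (6, true), (28, true)],
     [(0, false), (8, false), (40, false)], [(0, false), (8, true), (47, false)],
     [(0, false), (9, false), (25, false)], [(0, false), (10, false), (44, false)],
     [(0, false), (10, true), (46, false)], [(0, false), (11, true), (58, false)],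
     [(0, false), (12, false), (50, false)], [(0, false), (13, true), (48, false)],
     [(0, false), (14, true), (59, true)], [(0, false), (15, false), (56, false)],
     [(0, false), (18, false), (43, true)], [(0, false), (20, false), (42, true)],
     [(0, false), (23, false), (54, true)], [(0, false), (23, true), (49, false)],
     [(0, false), (24, false), (53, true)], [(0, false), (26, false), (54, false)]],
    by decide +kernel⟩

/-! ### Assembly -/

theorem exists_isRulerSystem {t : ℕ} (ht : Even t) (ht8 : 8 ≤ t) : ∃ L, IsRulerSystem t L := by
  obtain ⟨s, rfl⟩ := ht
  -- With `t = 2s`, these are the `s ≥ 4` below the starting points `18`, `10`, `8` of the families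
  -- with `s ≡ 0, 1, 2` modulo 3.
  by_cases h : s ∈ [4, 5, 6, 7, 9, 12, 15]
  · simp only [List.mem_cons, List.not_mem_nil, or_false] at h
    rcases h with rfl | rfl | rfl | rfl | rfl | rfl | rfl
    exacts [exists_isRulerSystem_8, exists_isRulerSystem_10, exists_isRulerSystem_12,
      exists_isRulerSystem_14, exists_isRulerSystem_18, exists_isRulerSystem_24,
      exists_isRulerSystem_30]
  · simp only [List.mem_cons, List.not_mem_nil, or_false, not_or] at h
    obtain ⟨k, hk | hk | hk⟩ : ∃ k,
        s + s = 6 * k + 36 ∨ s + s = 6 * k + 20 ∨ s + s = 6 * k + 16 := by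
      rcases (by omega : s % 3 = 0 ∨ s % 3 = 1 ∨ s % 3 = 2) with h | h | h
      exacts [⟨s / 3 - 6, by omega⟩, ⟨s / 3 - 3, by omega⟩, ⟨s / 3 - 2, by omega⟩]
    · exact ⟨_, hk ▸ isRulerSystem_rulersModZero k⟩
    · exact ⟨_, hk ▸ isRulerSystem_rulersModOne k⟩
    · exact ⟨_, hk ▸ isRulerSystem_rulersModTwo k⟩

theorem lemma4p13 (t : ℕ) (ht : Even t) (ht8 : 8 ≤ t) :
    ∃ F : Finset (Finset (ZMod (2 * 4 * t))), IsPerfectDifferenceFamily 2 4 t {3, 5} F := by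
  obtain ⟨L, hL⟩ := exists_isRulerSystem ht ht8
  exact hL.exists_isPerfectDifferenceFamily (by omega)
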